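/- There are absolute constants $a,b>0$ such that the following holds. Let $d\in\mathbb{N}$, let $\|\cdot\|$ be any norm on $\mathbb{R}^d$, let $X\subset\mathbb{R}^d$ be finite, and let $k\in\mathbb{N}$ with $1\le k\le|X|$. For a finite non-empty set $C\subset\mathbb{R}^d$ let $\mathrm{rad}(C)=\min_{y\in\mathbb{R}^d}\max_{x\in C}\|x-y\|$. A $k$-clustering of $X$ is a partition of $X$ into $k$ non-empty sets (clusters); its radius cost is the largest radius of its clusters, and $\mathrm{opt}_k$ denotes the minimum radius cost of a $k$-clustering of $X$. Let $\mathcal{C}_{|X|},\ldots,\mathcal{C}_1$ be computed by the agglomerative algorithm: $\mathcal{C}_{|X|}=\{\{x\}: x\in X\}$, and for $i=|X|-1,\ldots,1$ the family $\mathcal{C}_i$ arises from $\mathcal{C}_{i+1}$ by replacing two distinct clusters $A,B\in\mathcal{C}_{i+1}$ that minimise $\mathrm{rad}(A\cup B)$ with $A\cup B$, where ties are broken arbitrarily. Then $\mathcal{C}_k$ is a $k$-clustering of $X$, and its radius cost $\mathrm{cost}(\mathcal{C}_k)$ satisfies: 1. $\mathrm{cost}(\mathcal{C}_k)\le a\,e^{bd}\cdot\log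 k\cdot\mathrm{opt}_k$ if $k\ge 2$; that is, $\mathrm{cost}(\mathcal{C}_k)=O(\log k)\cdot\mathrm{opt}_k$ with a hidden constant that is singly exponential in $d$; 2. $\mathrm{cost}(\mathcal{C}_k)\le 2\bigl(2(\log_2 k+2)(24d\,e^{24d}+1)+\tfrac12\bigr)\cdot\mathrm{opt}_k$, with strict inequality if $k<|X|$. -/

import Mathlib

open scoped NNReal

noncomputable section

/-- The (continuous) radius of a finite set `C`: `min_y max_{x ∈ C} ‖x - y‖`, where the center `y`
ranges over the whole space. -/
def rad {E : Type*} [NormedAddCommGroup E] (C : Finset E) : ℝ≥0 :=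
  ⨅ y : E, C.sup fun x => ‖x - y‖₊

/-- The radius cost of a family of clusters: the largest radius of a cluster. -/
def radCost {E : Type*} [NormedAddCommGroup E] (𝒞 : Finset (Finset E)) : ℝ≥0 :=
  𝒞.sup rad

/-- `𝒞` is a `k`-clustering of `X`: a partition of `X` into `k` non-empty subsets. -/
def IsKClustering {E : Type*} [DecidableEq E] (X : Finset E) (k : ℕ)
    (𝒞 : Finset (Finset E)) : Prop :=
  𝒞.card = k ∧ ∃ P : Finpartition X, P.parts = 𝒞

/-- The cost of an optimal `k`-center clustering of `X`: the least radius cost of a `k`-clustering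
of `X`. -/
def optRadCost {E : Type*} [NormedAddCommGroup E] [DecidableEq E] (X : Finset E) (k : ℕ) : ℝ≥0 :=
  sInf {r | ∃ 𝒞, IsKClustering X k 𝒞 ∧ radCost 𝒞 = r}

/-- `𝒞 |X|, …, 𝒞 1` is the output of a run of the agglomerative radius algorithm on `X`. It starts
with the singletons; to get `𝒞 i` from `𝒞 (i + 1)`, it merges two distinct clusters `A`, `B` that
minimize the radius of `A ∪ B`. Ties may be broken in any way. Only the values `𝒞 i` with
`1 ≤ i ≤ |X|` matter. -/
structure IsAgglomerativeRadiusRun {E : Type*} [NormedAddCommGroup E] [DecidableEq E]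
    (X : Finset E) (𝒞 : ℕ → Finset (Finset E)) : Prop where
  start : 𝒞 X.card = X.image fun x => {x}
  step : ∀ i : ℕ, 1 ≤ i → i < X.card →
    ∃ A ∈ 𝒞 (i + 1), ∃ B ∈ 𝒞 (i + 1), A ≠ B ∧
      (∀ A' ∈ 𝒞 (i + 1), ∀ B' ∈ 𝒞 (i + 1), A' ≠ B' → rad (A ∪ B) ≤ rad (A' ∪ B')) ∧
      𝒞 i = (𝒞 (i + 1) \ {A, B}) ∪ {A ∪ B}

end

/-! For `k < |X|` the cost is at most `6 * exp (8 * d) * opt_k`, a factor free of `k`; both claimed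
bounds are weaker than this.

Let `r` be the cost of an optimal clustering `P`, and stop at the last stage `m` of cost at most `r`
(if `m` is not yet `k`). There every union of two clusters has radius above `r`. Hence a part of `P`
that shares no cluster with another part is itself a cluster. The remaining parts form a graph
without isolated vertices, which has a dominating set of at most half its size. So, apart from at
most `s` clusters, all clusters meet a `5 * r`-neighbourhood of a set `D` with `2 * D.card ≤ k'`,
where `s + k' = k` (`exists_cover`).

From then on, volume packing bounds the price of each merge. While about `j` clusters near `D`
remain, two of them have centers at distance `O((ρ + R) * (k' / j) ^ (1 / d))`, with `ρ` the current
cost and `R = 5 * r`. Running `j` down by factors of about `3 / 2` multiplies `ρ + R` by `exp (2 *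
(k' / j) ^ (1 / d))` each time; the exponents form a geometric series with sum at most `8 * d`
(`radCost_add_le`). The halving of `D` is what lets packing work all the way down to `j = k'`, so no
logarithmic loss occurs. -/

open scoped NNReal

/-! ### Radii and centers -/

section Radius

variable {E : Type*} [NormedAddCommGroup E]

theorem rad_le_of_forall_norm_sub_le {C : Finset E} {y : E} {t : ℝ} (ht : 0 ≤ t)
    (h : ∀ x ∈ C, ‖x - y‖ ≤ t) : (rad C : ℝ) ≤ t := by
  lift t to ℝ≥0 using ht
  refine NNReal.coe_le_coe.2 ((ciInf_le' _ y).trans (Finset.sup_le fun x hx => ?_))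
  exact_mod_cast h x hx

theorem exists_center [ProperSpace E] (C : Finset E) : ∃ y, ∀ x ∈ C, ‖x - y‖ ≤ rad C := by
  rcases C.eq_empty_or_nonempty with rfl | ⟨x₀, hx₀⟩
  · exact ⟨0, by simp⟩
  have hcont : Continuous fun y : E => C.sup fun x => ‖x - y‖₊ :=
    Continuous.finset_sup_apply fun x _ => by fun_prop
  have htend : Filter.Tendsto (fun y : E => C.sup fun x => ‖x - y‖₊)
      (Filter.cocompact E) Filter.atTop := by
    refine Filter.tendsto_atTop_mono (f := fun y : E => ‖x₀ - y‖₊)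
      (fun y => Finset.le_sup (f := fun x => ‖x - y‖₊) hx₀) ?_
    rw [← NNReal.tendsto_coe_atTop]
    exact (tendsto_dist_left_cocompact_atTop x₀).congr fun y => dist_eq_norm x₀ y
  obtain ⟨y, hy⟩ := hcont.exists_forall_le htend
  refine ⟨y, fun x hx => ?_⟩
  have h1 : ‖x - y‖₊ ≤ rad C :=
    (Finset.le_sup (f := fun x => ‖x - y‖₊) hx).trans (le_ciInf hy)
  exact_mod_cast h1

theorem rad_mono {A B : Finset E} (h : A ⊆ B) : rad A ≤ rad B :=
  ciInf_mono (OrderBot.bddBelow _) fun _ => Finset.sup_mono h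

theorem rad_singleton (x : E) : rad {x} = 0 := by
  have : (rad {x} : ℝ) ≤ 0 := rad_le_of_forall_norm_sub_le (y := x) le_rfl (by simp)
  exact le_antisymm (by exact_mod_cast this) bot_le

theorem rad_le_radCost {𝒞 : Finset (Finset E)} {A : Finset E} (hA : A ∈ 𝒞) :
    rad A ≤ radCost 𝒞 := Finset.le_sup hA

/-- The midpoint of `x` and `y` serves as the center. -/
theorem rad_union_le [DecidableEq E] [NormedSpace ℝ E] {A B : Finset E} {x y : E} {ρ δ : ℝ}
    (hρ : 0 ≤ ρ) (hA : ∀ z ∈ A, ‖z - x‖ ≤ ρ) (hB : ∀ z ∈ B, ‖z - y‖ ≤ ρ) (hxy : ‖x - y‖ ≤ 2 * δ) :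
    (rad (A ∪ B) : ℝ) ≤ ρ + δ := by
  have hm : ‖x - midpoint ℝ x y‖ ≤ δ := by
    rw [← dist_eq_norm, dist_left_midpoint, dist_eq_norm, Real.norm_ofNat]; linarith
  have hm' : ‖y - midpoint ℝ x y‖ ≤ δ := by
    rw [← dist_eq_norm, dist_right_midpoint, dist_eq_norm, Real.norm_ofNat]; linarith
  have hδ : 0 ≤ δ := (norm_nonneg _).trans hm
  refine rad_le_of_forall_norm_sub_le (y := midpoint ℝ x y) (by positivity) fun z hz => ?_
  rcases Finset.mem_union.1 hz with hz | hz
  · have := norm_sub_le_norm_sub_add_norm_sub z x (midpoint ℝ x y)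
    linarith [hA z hz]
  · have := norm_sub_le_norm_sub_add_norm_sub z y (midpoint ℝ x y)
    linarith [hB z hz]

end Radius

/-! ### Volume packing -/

section Packing

open MeasureTheory Metric

variable {E : Type*} [NormedAddCommGroup E] [NormedSpace ℝ E] [FiniteDimensional ℝ E]

/-- The disjoint `δ`-balls around the `c i` lie in the `T + δ`-balls around `D`; compare Haar
measures. -/
theorem card_mul_pow_le_of_separated {ι : Type*} (S : Finset ι) (c : ι → E) (D : Finset E)
    {T δ : ℝ} (hT : 0 ≤ T) (hδ : 0 < δ)
    (hcover : ∀ i ∈ S, ∃ y ∈ D, ‖c i - y‖ ≤ T)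
    (hsep : ∀ i ∈ S, ∀ j ∈ S, i ≠ j → 2 * δ ≤ ‖c i - c j‖) :
    S.card * δ ^ Module.finrank ℝ E ≤ D.card * (T + δ) ^ Module.finrank ℝ E := by
  borelize E
  let μ : Measure E := Measure.addHaar
  have hsub : (⋃ i ∈ S, ball (c i) δ) ⊆ ⋃ y ∈ D, ball y (T + δ) := by
    intro z hz
    simp only [Set.mem_iUnion, mem_ball, exists_prop] at hz ⊢
    obtain ⟨i, hi, hz⟩ := hz
    obtain ⟨y, hy, hiy⟩ := hcover i hi
    refine ⟨y, hy, ?_⟩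
    rw [← dist_eq_norm] at hiy
    linarith [dist_triangle z (c i) y]
  have hdisj : (S : Set ι).PairwiseDisjoint fun i => ball (c i) δ := by
    intro i hi j hj hij
    apply ball_disjoint_ball
    rw [dist_eq_norm]
    linarith [hsep i hi j hj hij]
  have hS : μ (⋃ i ∈ S, ball (c i) δ)
      = ENNReal.ofReal (S.card * δ ^ Module.finrank ℝ E) * μ (ball 0 1) := by
    rw [measure_biUnion_finset hdisj fun _ _ => measurableSet_ball]
    simp only [Measure.addHaar_ball_of_pos μ _ hδ, Finset.sum_const, nsmul_eq_mul]
    rw [ENNReal.ofReal_mul (by positivity), ENNReal.ofReal_natCast, mul_assoc]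
  have hD : μ (⋃ y ∈ D, ball y (T + δ))
      ≤ ENNReal.ofReal (D.card * (T + δ) ^ Module.finrank ℝ E) * μ (ball 0 1) := by
    refine (measure_biUnion_finset_le _ _).trans ?_
    simp only [Measure.addHaar_ball_of_pos μ _ (add_pos_of_nonneg_of_pos hT hδ),
      Finset.sum_const, nsmul_eq_mul]
    rw [ENNReal.ofReal_mul (by positivity), ENNReal.ofReal_natCast, mul_assoc]
  have h := (hS.symm.trans_le (measure_mono hsub)).trans hD
  rw [ENNReal.mul_le_mul_iff_left (measure_ball_pos μ _ one_pos).ne' measure_ball_lt_top.ne] at h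
  exact (ENNReal.ofReal_le_ofReal_iff (by positivity)).1 h

/-- Among more than `D.card` points, each within distance `T` of the set `D`, some two are close
to each other. -/
theorem exists_norm_sub_le_of_card_lt {ι : Type*} (S : Finset ι) (c : ι → E) (D : Finset E)
    {T : ℝ} (hT : 0 < T) (hd : Module.finrank ℝ E ≠ 0)
    (hcover : ∀ i ∈ S, ∃ y ∈ D, ‖c i - y‖ ≤ T) (hcard : D.card < S.card) :
    ∃ i ∈ S, ∃ j ∈ S, i ≠ j ∧
      ‖c i - c j‖ ≤ 2 * (2 * T * ((D.card : ℝ) / S.card) ^ (1 / (Module.finrank ℝ E : ℝ))) := by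
  set v : ℝ := ((D.card : ℝ) / S.card) ^ (1 / (Module.finrank ℝ E : ℝ)) with hv
  have hSpos : (0 : ℝ) < S.card := by exact_mod_cast (Nat.zero_le _).trans_lt hcard
  have hv0 : 0 ≤ v := by positivity
  by_contra! hcon
  choose! f hfD hf using hcover
  obtain ⟨i, hi, j, hj, hij, hfij⟩ := Finset.exists_ne_map_eq_of_card_lt_of_maps_to hcard hfD
  have hDpos : (0 : ℝ) < D.card := by
    exact_mod_cast Finset.card_pos.2 ⟨f i, hfD i hi⟩
  have hle : ‖c i - c j‖ ≤ 2 * T := by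
    have h1 := norm_sub_le_norm_sub_add_norm_sub (c i) (f i) (c j)
    have h2 := hf i hi
    have h3 := hf j hj
    rw [← hfij, norm_sub_rev] at h3
    linarith
  -- The pigeonhole pair is at distance at most `2 * T`, which settles `v ≥ 1 / 2`. Otherwise `δ = 2
  -- * T * v < T`, and packing would give `(2 * T) ^ d ≤ (T + δ) ^ d`.
  have hlt : 2 * T * v < T := by linarith [hcon i hi j hj hij]
  have hvpow : v ^ Module.finrank ℝ E = (D.card : ℝ) / S.card := by
    rw [hv, ← Real.rpow_natCast, ← Real.rpow_mul (by positivity), one_div_mul_cancel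
      (by exact_mod_cast hd), Real.rpow_one]
  have hpack := card_mul_pow_le_of_separated S c D hT.le (δ := 2 * T * v) (by positivity)
    (fun i hi => ⟨f i, hfD i hi, hf i hi⟩) fun i hi j hj hij => (hcon i hi j hj hij).le
  rw [mul_pow, hvpow] at hpack
  have h4 : (T + 2 * T * v) ^ Module.finrank ℝ E < (2 * T) ^ Module.finrank ℝ E :=
    pow_lt_pow_left₀ (by linarith) (by positivity) hd
  have h5 : (S.card : ℝ) * ((2 * T) ^ Module.finrank ℝ E * (D.card / S.card))
      = D.card * (2 * T) ^ Module.finrank ℝ E := by field_simp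
  rw [h5] at hpack
  exact absurd (le_of_mul_le_mul_left hpack hDpos) (not_le.2 h4)

end Packing

/-! ### Dominating sets and merging in partitions -/

/-- A symmetric relation without isolated points on a finite set has a dominating set that contains
at most half of the points. -/
theorem exists_dominating_two_mul_card_le {α : Type*} [DecidableEq α] (W : Finset α)
    (r : α → α → Prop) (hsymm : ∀ v w, r v w → r w v) (hirr : ∀ v, ¬ r v v)
    (hr : ∀ v ∈ W, ∃ w ∈ W, r v w) :
    ∃ D ⊆ W, 2 * D.card ≤ W.card ∧ ∀ v ∈ W, v ∈ D ∨ ∃ w ∈ D, r v w := by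
  classical
  let dom : Finset α → Prop := fun D => ∀ v ∈ W, v ∈ D ∨ ∃ w ∈ D, r v w
  obtain ⟨D, hDmem, hmin⟩ := (W.powerset.filter dom).exists_min_image Finset.card
    ⟨W, by simp only [Finset.mem_filter, Finset.mem_powerset_self, true_and]
           exact fun v hv => Or.inl hv⟩
  obtain ⟨hDW, hD⟩ := Finset.mem_filter.1 hDmem
  rw [Finset.mem_powerset] at hDW
  -- The complement of a minimum dominating set dominates too: a vertex it misses would lie in `D`
  -- with all its neighbours, and could be erased from `D`.
  have hcompl : dom (W \ D) := by
    intro v hv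
    by_contra! hcon
    obtain ⟨hvD, hno⟩ := hcon
    have hvD : v ∈ D := by
      by_contra h
      exact hvD (Finset.mem_sdiff.2 ⟨hv, h⟩)
    have hnbr : ∀ w ∈ W, r v w → w ∈ D := fun w hw hvw => by
      by_contra h
      exact hno w (Finset.mem_sdiff.2 ⟨hw, h⟩) hvw
    have hdom : dom (D.erase v) := by
      intro u hu
      by_cases huv : u = v
      · subst huv
        obtain ⟨w, hw, huw⟩ := hr u hu
        refine Or.inr ⟨w, Finset.mem_erase.2 ⟨?_, hnbr w hw huw⟩, huw⟩
        rintro rfl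
        exact hirr _ huw
      · by_cases huD : u ∈ D
        · exact Or.inl (Finset.mem_erase.2 ⟨huv, huD⟩)
        · obtain ⟨w, hwD, huw⟩ := (hD u hu).resolve_left huD
          refine Or.inr ⟨w, Finset.mem_erase.2 ⟨?_, hwD⟩, huw⟩
          rintro rfl
          exact huD (hnbr u hu (hsymm _ _ huw))
    have h1 := hmin (D.erase v) (Finset.mem_filter.2
      ⟨Finset.mem_powerset.2 ((Finset.erase_subset _ _).trans hDW), hdom⟩)
    exact absurd h1 (not_le.2 (Finset.card_erase_lt_of_mem hvD))
  refine ⟨D, hDW, ?_, hD⟩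
  have h1 := hmin (W \ D) (Finset.mem_filter.2
    ⟨Finset.mem_powerset.2 Finset.sdiff_subset, hcompl⟩)
  have h2 := Finset.card_sdiff_add_card_eq_card hDW
  omega

theorem Finpartition.exists_merge {α : Type*} [DecidableEq α] {X : Finset α} (P : Finpartition X)
    {A B : Finset α} (hA : A ∈ P.parts) (hB : B ∈ P.parts) (hAB : A ≠ B) :
    ∃ Q : Finpartition X, Q.parts = (P.parts \ {A, B}) ∪ {A ∪ B} ∧
      Q.parts.card + 1 = P.parts.card := by
  have hdis : ∀ C ∈ P.parts, ∀ x ∈ C, ∀ C' ∈ P.parts, x ∈ C' → C = C' :=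
    fun C hC x hx C' hC' hx' => P.eq_of_mem_parts hC hC' hx hx'
  let parts := (P.parts \ {A, B}) ∪ {A ∪ B}
  have hmem : ∀ C, C ∈ parts ↔ (C ∈ P.parts ∧ C ≠ A ∧ C ≠ B) ∨ C = A ∪ B := by
    intro C
    simp [parts, or_comm]
  refine ⟨Finpartition.ofExistsUnique parts ?_ ?_ ?_, rfl, ?_⟩
  · intro C hC
    rcases (hmem C).1 hC with ⟨hC, -⟩ | rfl
    · exact P.le hC
    · exact Finset.union_subset (P.le hA) (P.le hB)
  · intro x hx
    obtain ⟨C, hC, hxC⟩ := P.exists_mem hx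
    by_cases h : C = A ∨ C = B
    · refine ⟨A ∪ B, ⟨(hmem _).2 (Or.inr rfl), ?_⟩, ?_⟩
      · rcases h with rfl | rfl <;> simp [hxC]
      · rintro C' ⟨hC', hxC'⟩
        rcases (hmem C').1 hC' with ⟨hC', h1, h2⟩ | rfl
        · have := hdis C hC x hxC C' hC' hxC'
          subst this
          exact absurd h (by tauto)
        · rfl
    · push Not at h
      refine ⟨C, ⟨(hmem _).2 (Or.inl ⟨hC, h⟩), hxC⟩, ?_⟩
      rintro C' ⟨hC', hxC'⟩
      rcases (hmem C').1 hC' with ⟨hC', h1, h2⟩ | rfl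
      · exact hdis C' hC' x hxC' C hC hxC
      · rcases Finset.mem_union.1 hxC' with hx' | hx'
        · exact absurd (hdis C hC x hxC A hA hx') h.1
        · exact absurd (hdis C hC x hxC B hB hx') h.2
  · intro h
    rcases (hmem ∅).1 h with ⟨h, -⟩ | h
    · exact P.empty_notMem_parts h
    · exact P.ne_empty hA (Finset.union_eq_empty.1 h.symm).1
  · have hnot : A ∪ B ∉ P.parts \ {A, B} := by
      intro h
      obtain ⟨h, h'⟩ := Finset.mem_sdiff.1 h
      obtain ⟨x, hx⟩ := P.nonempty_of_mem_parts hA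
      have := hdis A hA x hx _ h (Finset.mem_union_left _ hx)
      exact h' (by rw [← this]; simp)
    have h2 : ({A, B} : Finset (Finset α)) ⊆ P.parts := by
      intro C hC
      rcases Finset.mem_insert.1 hC with rfl | hC
      · exact hA
      · rwa [Finset.mem_singleton.1 hC]
    change (P.parts \ {A, B} ∪ {A ∪ B}).card + 1 = _
    rw [Finset.card_union_of_disjoint (Finset.disjoint_singleton_right.2 hnot),
      ← Finset.card_sdiff_add_card_eq_card h2, Finset.card_pair hAB, Finset.card_singleton]

/-! ### Structure of a run -/

namespace IsAgglomerativeRadiusRun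

variable {E : Type*} [NormedAddCommGroup E] [DecidableEq E] {X : Finset E}
  {𝒞 : ℕ → Finset (Finset E)}

theorem isKClustering (h : IsAgglomerativeRadiusRun X 𝒞) {i : ℕ} (hi : 1 ≤ i)
    (hiX : i ≤ X.card) : IsKClustering X i (𝒞 i) := by
  induction hiX using Nat.decreasingInduction with
  | self =>
    have hbot : (⊥ : Finpartition X).parts = 𝒞 X.card := by
      rw [h.start]
      ext t
      simp
    exact ⟨by rw [← hbot, Finpartition.card_bot], ⊥, hbot⟩
  | of_succ i hiX ih =>
    obtain ⟨hcard, P, hP⟩ := ih (by omega)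
    obtain ⟨A, hA, B, hB, hAB, -, hstep⟩ := h.step i hi hiX
    rw [← hP] at hA hB hstep hcard
    obtain ⟨Q, hQ, hQcard⟩ := P.exists_merge hA hB hAB
    rw [← hQ] at hstep
    exact ⟨by rw [hstep]; omega, Q, hstep.symm⟩

theorem card_eq (h : IsAgglomerativeRadiusRun X 𝒞) {i : ℕ} (hi : 1 ≤ i)
    (hiX : i ≤ X.card) : (𝒞 i).card = i := (h.isKClustering hi hiX).1

theorem nonempty_of_mem (h : IsAgglomerativeRadiusRun X 𝒞) {i : ℕ} (hi : 1 ≤ i)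
    (hiX : i ≤ X.card) {A : Finset E} (hA : A ∈ 𝒞 i) : A.Nonempty := by
  obtain ⟨-, P, hP⟩ := h.isKClustering hi hiX
  rw [← hP] at hA
  exact P.nonempty_of_mem_parts hA

theorem subset_of_mem (h : IsAgglomerativeRadiusRun X 𝒞) {i : ℕ} (hi : 1 ≤ i)
    (hiX : i ≤ X.card) {A : Finset E} (hA : A ∈ 𝒞 i) : A ⊆ X := by
  obtain ⟨-, P, hP⟩ := h.isKClustering hi hiX
  rw [← hP] at hA
  exact P.le hA

theorem exists_mem (h : IsAgglomerativeRadiusRun X 𝒞) {i : ℕ} (hi : 1 ≤ i)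
    (hiX : i ≤ X.card) {x : E} (hx : x ∈ X) : ∃ A ∈ 𝒞 i, x ∈ A := by
  obtain ⟨-, P, hP⟩ := h.isKClustering hi hiX
  rw [← hP]
  exact P.exists_mem hx

theorem eq_of_mem (h : IsAgglomerativeRadiusRun X 𝒞) {i : ℕ} (hi : 1 ≤ i)
    (hiX : i ≤ X.card) {A B : Finset E} (hA : A ∈ 𝒞 i) (hB : B ∈ 𝒞 i) {x : E} (hxA : x ∈ A)
    (hxB : x ∈ B) : A = B := by
  obtain ⟨-, P, hP⟩ := h.isKClustering hi hiX
  rw [← hP] at hA hB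
  exact P.eq_of_mem_parts hA hB hxA hxB

theorem exists_superset (h : IsAgglomerativeRadiusRun X 𝒞) {i j : ℕ} (hi : 1 ≤ i) (hij : i ≤ j)
    (hjX : j ≤ X.card) {A : Finset E} (hA : A ∈ 𝒞 j) : ∃ B ∈ 𝒞 i, A ⊆ B := by
  induction hij using Nat.decreasingInduction with
  | self => exact ⟨A, hA, subset_rfl⟩
  | of_succ i hij ih =>
    obtain ⟨C, hC, hAC⟩ := ih (by omega)
    obtain ⟨A', hA', B', hB', hne, -, hstep⟩ := h.step i hi (by omega)
    rw [hstep]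
    by_cases hmem : C = A' ∨ C = B'
    · refine ⟨A' ∪ B', by simp, hAC.trans ?_⟩
      rcases hmem with rfl | rfl
      · exact Finset.subset_union_left
      · exact Finset.subset_union_right
    · refine ⟨C, ?_, hAC⟩
      push Not at hmem
      simp [hC, hmem]

/-- Each merge destroys only two clusters, so many clusters survive a short stretch of the run
unchanged. -/
theorem card_sdiff_le (h : IsAgglomerativeRadiusRun X 𝒞) {i j : ℕ} (hi : 1 ≤ i) (hij : i ≤ j)
    (hjX : j ≤ X.card) : (𝒞 j \ 𝒞 i).card ≤ 2 * (j - i) := by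
  induction hij using Nat.decreasingInduction with
  | self => simp
  | of_succ i hij ih =>
    obtain ⟨A, hA, B, hB, hne, -, hstep⟩ := h.step i hi (by omega)
    have hsub : 𝒞 j \ 𝒞 i ⊆ (𝒞 j \ 𝒞 (i + 1)) ∪ {A, B} := by
      intro C hC
      simp only [hstep, Finset.mem_sdiff, Finset.mem_union, Finset.mem_insert,
        Finset.mem_singleton] at hC ⊢
      tauto
    have h1 := (Finset.card_le_card hsub).trans (Finset.card_union_le _ _)
    rw [Finset.card_pair hne] at h1
    have h2 := ih (by omega)
    omega

theorem radCost_card (h : IsAgglomerativeRadiusRun X 𝒞) : radCost (𝒞 X.card) = 0 := by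
  rw [radCost, h.start, ← bot_eq_zero, Finset.sup_eq_bot_iff]
  intro A hA
  obtain ⟨x, -, rfl⟩ := Finset.mem_image.1 hA
  exact rad_singleton x

/-- If some two distinct clusters have a union of radius at most `β`, then so have the clusters
that the algorithm merges. -/
theorem radCost_le_max (h : IsAgglomerativeRadiusRun X 𝒞) {i : ℕ} (hi : 1 ≤ i) (hiX : i < X.card)
    {A B : Finset E} (hA : A ∈ 𝒞 (i + 1)) (hB : B ∈ 𝒞 (i + 1)) (hAB : A ≠ B) :
    radCost (𝒞 i) ≤ max (radCost (𝒞 (i + 1))) (rad (A ∪ B)) := by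
  obtain ⟨A', hA', B', hB', hne, hmin, hstep⟩ := h.step i hi hiX
  refine Finset.sup_le fun C hC => ?_
  rw [hstep, Finset.mem_union, Finset.mem_singleton] at hC
  rcases hC with hC | rfl
  · exact le_max_of_le_left (rad_le_radCost (Finset.sdiff_subset hC))
  · exact le_max_of_le_right (hmin A hA B hB hAB)

theorem radCost_le_of_forall_exists (h : IsAgglomerativeRadiusRun X 𝒞) {m M : ℕ} {β : ℝ}
    (hm : 1 ≤ m) (hmM : m ≤ M) (hM : M ≤ X.card) (hβ : (radCost (𝒞 M) : ℝ) ≤ β)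
    (hex : ∀ i, m ≤ i → i < M →
      ∃ A ∈ 𝒞 (i + 1), ∃ B ∈ 𝒞 (i + 1), A ≠ B ∧ (rad (A ∪ B) : ℝ) ≤ β) :
    (radCost (𝒞 m) : ℝ) ≤ β := by
  induction hmM using Nat.decreasingInduction with
  | self => exact hβ
  | of_succ m hmM ih =>
    obtain ⟨A, hA, B, hB, hAB, hrad⟩ := hex m le_rfl hmM
    have h1 : (radCost (𝒞 m) : ℝ) ≤ max (radCost (𝒞 (m + 1)) : ℝ) (rad (A ∪ B)) := by
      exact_mod_cast h.radCost_le_max hm (by omega) hA hB hAB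
    exact h1.trans (max_le (ih (by omega) fun i hi hiM => hex i (by omega) hiM) hrad)

end IsAgglomerativeRadiusRun

/-! ### Clusters near `D` and the growth of the cost -/

open Classical in
/-- The clusters of `𝒟` that have no point within distance `R` of the set `D`. -/
noncomputable def farClusters {E : Type*} [NormedAddCommGroup E] (D : Finset E) (R : ℝ)
    (𝒟 : Finset (Finset E)) : Finset (Finset E) :=
  𝒟.filter fun A => ∀ x ∈ A, ∀ y ∈ D, R < ‖x - y‖

theorem mem_farClusters {E : Type*} [NormedAddCommGroup E] {D : Finset E} {R : ℝ}
    {𝒟 : Finset (Finset E)} {A : Finset E} :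
    A ∈ farClusters D R 𝒟 ↔ A ∈ 𝒟 ∧ ∀ x ∈ A, ∀ y ∈ D, R < ‖x - y‖ := by
  simp [farClusters]

namespace IsAgglomerativeRadiusRun

variable {E : Type*} [NormedAddCommGroup E] [DecidableEq E] {X : Finset E}
  {𝒞 : ℕ → Finset (Finset E)}

/-- A far cluster of the coarser stage contains a cluster of the finer stage, again far;
disjointness makes the choice injective. -/
theorem card_farClusters_mono (h : IsAgglomerativeRadiusRun X 𝒞) (D : Finset E) (R : ℝ) {i j : ℕ}
    (hi : 1 ≤ i) (hij : i ≤ j) (hjX : j ≤ X.card) :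
    (farClusters D R (𝒞 i)).card ≤ (farClusters D R (𝒞 j)).card := by
  have hex : ∀ A ∈ farClusters D R (𝒞 i), ∃ B ∈ farClusters D R (𝒞 j), B ⊆ A := by
    intro A hA
    obtain ⟨hA, hfar⟩ := mem_farClusters.1 hA
    obtain ⟨x, hx⟩ := h.nonempty_of_mem hi (hij.trans hjX) hA
    obtain ⟨B, hB, hxB⟩ :=
      h.exists_mem (hi.trans hij) hjX (h.subset_of_mem hi (hij.trans hjX) hA hx)
    obtain ⟨A', hA', hBA'⟩ := h.exists_superset hi hij hjX hB
    obtain rfl := h.eq_of_mem hi (hij.trans hjX) hA hA' hx (hBA' hxB)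
    exact ⟨B, mem_farClusters.2 ⟨hB, fun y hy => hfar y (hBA' hy)⟩, hBA'⟩
  choose! f hf hfA using hex
  refine Finset.card_le_card_of_injOn f hf fun A hA B hB hAB => ?_
  obtain ⟨x, hx⟩ := h.nonempty_of_mem (hi.trans hij) hjX (mem_farClusters.1 (hf A hA)).1
  exact h.eq_of_mem hi (hij.trans hjX) (mem_farClusters.1 hA).1 (mem_farClusters.1 hB).1
    (hfA A hA hx) (hfA B hB (hAB ▸ hx))

variable [NormedSpace ℝ E] [FiniteDimensional ℝ E]

/-- If more than `D.card` clusters close to `D` of the stage `M` are still there at the stage `i`,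
then some two of them have a union of small radius. -/
theorem exists_rad_union_le (h : IsAgglomerativeRadiusRun X 𝒞) (hd : Module.finrank ℝ E ≠ 0)
    (D : Finset E) {R : ℝ} (hR : 0 < R) {i M n : ℕ} (hi : 1 ≤ i) (hiM : i ≤ M) (hM : M ≤ X.card)
    (hn : n + (farClusters D R (𝒞 M)).card + 2 * (M - i) ≤ M) (hDn : D.card < n) :
    ∃ A ∈ 𝒞 i, ∃ B ∈ 𝒞 i, A ≠ B ∧ (rad (A ∪ B) : ℝ) ≤ radCost (𝒞 M) +
      2 * (radCost (𝒞 M) + R) * ((D.card : ℝ) / n) ^ (1 / (Module.finrank ℝ E : ℝ)) := by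
  have : ProperSpace E := FiniteDimensional.proper ℝ E
  set ρ : ℝ := ↑(radCost (𝒞 M))
  have hρ0 : 0 ≤ ρ := NNReal.coe_nonneg _
  choose c hc using exists_center (E := E)
  have hcρ : ∀ A ∈ 𝒞 M, ∀ x ∈ A, ‖x - c A‖ ≤ ρ := fun A hA x hx =>
    (hc A x hx).trans (by exact_mod_cast rad_le_radCost hA)
  -- Only clusters unchanged since stage `M` are used, so their radii are bounded by the cost of
  -- stage `M` even if stage `i` costs more.
  let S := (𝒞 M ∩ 𝒞 i) \ farClusters D R (𝒞 M)
  have hnS : n ≤ S.card := by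
    have h1 := h.card_eq (hi.trans hiM) hM
    have h2 := Finset.card_inter_add_card_sdiff (𝒞 M) (𝒞 i)
    have h3 := h.card_sdiff_le hi hiM hM
    have h4 := Finset.le_card_sdiff (farClusters D R (𝒞 M)) (𝒞 M ∩ 𝒞 i)
    change n ≤ ((𝒞 M ∩ 𝒞 i) \ farClusters D R (𝒞 M)).card
    omega
  have hS : ∀ A ∈ S, A ∈ 𝒞 M ∧ A ∈ 𝒞 i ∧ ∃ x ∈ A, ∃ y ∈ D, ‖x - y‖ ≤ R := by
    intro A hA
    obtain ⟨hA, hfar⟩ := Finset.mem_sdiff.1 hA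
    obtain ⟨hAM, hAi⟩ := Finset.mem_inter.1 hA
    refine ⟨hAM, hAi, ?_⟩
    by_contra! hcon
    exact hfar (mem_farClusters.2 ⟨hAM, hcon⟩)
  have hcover : ∀ A ∈ S, ∃ y ∈ D, ‖c A - y‖ ≤ ρ + R := by
    intro A hA
    obtain ⟨hAM, -, x, hx, y, hy, hxy⟩ := hS A hA
    refine ⟨y, hy, ?_⟩
    have h1 := norm_sub_le_norm_sub_add_norm_sub (c A) x y
    have h2 := hcρ A hAM x hx
    rw [norm_sub_rev] at h2
    linarith
  obtain ⟨A, hA, B, hB, hAB, hcAB⟩ := exists_norm_sub_le_of_card_lt S c D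
    (add_pos_of_nonneg_of_pos hρ0 hR) hd hcover (hDn.trans_le hnS)
  refine ⟨A, (hS A hA).2.1, B, (hS B hB).2.1, hAB, ?_⟩
  refine rad_union_le hρ0 (hcρ A (hS A hA).1) (hcρ B (hS B hB).1) (hcAB.trans ?_)
  have hn0 : (0 : ℝ) < n := by exact_mod_cast (Nat.zero_le _).trans_lt hDn
  have hnS' : (n : ℝ) ≤ S.card := by exact_mod_cast hnS
  gcongr

/-- The cost of the stage `m` in terms of the cost of the stage `m₀`, when at most `s` clusters of
the stage `m₀` are far from `D` and `m - s` is at least `k ≥ 2 * D.card`. -/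
theorem radCost_add_le (h : IsAgglomerativeRadiusRun X 𝒞) {d : ℕ} (hdim : Module.finrank ℝ E = d)
    (hd : d ≠ 0) (D : Finset E) {R : ℝ} (hR : 0 < R) {s k m₀ : ℕ} (hm₀ : m₀ ≤ X.card)
    (hfar : (farClusters D R (𝒞 m₀)).card ≤ s) (hk : 2 ≤ k) (hDk : 2 * D.card ≤ k)
    (j : ℕ) (hkj : k ≤ j) (hj : s + j ≤ m₀) :
    (radCost (𝒞 (s + j)) : ℝ) + R ≤
      (radCost (𝒞 m₀) + R) * Real.exp (8 * d * ((k : ℝ) / j) ^ (1 / (d : ℝ))) := by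
  induction hn : m₀ - j using Nat.strong_induction_on generalizing j with
  | _ N ih =>
  have hj0 : (0 : ℝ) < j := by exact_mod_cast (by omega : 0 < j)
  have hd1 : (1 : ℝ) ≤ d := by exact_mod_cast Nat.one_le_iff_ne_zero.2 hd
  set u : ℝ := ((k : ℝ) / j) ^ (1 / (d : ℝ)) with hu
  have hu0 : 0 ≤ u := by positivity
  have hcost0 : (0 : ℝ) ≤ radCost (𝒞 m₀) := NNReal.coe_nonneg _
  have step : ∀ J, j ≤ J → 2 * J ≤ 3 * j → s + J ≤ m₀ →
      (radCost (𝒞 (s + j)) : ℝ) + R ≤ (radCost (𝒞 (s + J)) + R) * Real.exp (2 * u) := by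
    intro J hjJ hJ hJm₀
    set ρ : ℝ := ↑(radCost (𝒞 (s + J)))
    have hρ0 : 0 ≤ ρ := NNReal.coe_nonneg _
    have hkey : (radCost (𝒞 (s + j)) : ℝ) ≤ ρ + 2 * (ρ + R) * u := by
      refine h.radCost_le_of_forall_exists (M := s + J) (by omega) (by omega) (by omega)
        (by have : 0 ≤ 2 * (ρ + R) * u := by positivity
            linarith) fun i hi hiM => ?_
      have hfarJ := h.card_farClusters_mono D R (i := s + J) (j := m₀) (by omega) hJm₀ hm₀
      -- In the worst case `i = s + j`, at most `2 * (J - j - 1)` of the `s + J` clusters are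
      -- destroyed and at most `s` are far, which leaves `2 * j + 2 - J`. By `2 * J ≤ 3 * j` this
      -- exceeds `j / 2 ≥ k / 2 ≥ D.card`.
      obtain ⟨A, hA, B, hB, hAB, hrad⟩ := h.exists_rad_union_le (by rwa [hdim]) D hR
        (i := i + 1) (M := s + J) (n := 2 * j + 2 - J) (by omega) (by omega) (by omega)
        (by omega) (by omega)
      refine ⟨A, hA, B, hB, hAB, hrad.trans ?_⟩
      rw [hdim]
      have hn : (j : ℝ) ≤ 2 * ((2 * j + 2 - J : ℕ) : ℝ) := by
        exact_mod_cast (by omega : j ≤ 2 * (2 * j + 2 - J))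
      have hD : 2 * (D.card : ℝ) ≤ k := by exact_mod_cast hDk
      have hdiv : (D.card : ℝ) / (2 * j + 2 - J : ℕ) ≤ (k : ℝ) / j := by
        rw [div_le_div_iff₀ (by linarith) hj0]
        nlinarith [(Nat.cast_nonneg D.card : (0 : ℝ) ≤ D.card)]
      rw [hu]
      gcongr
    have hexp := Real.add_one_le_exp (2 * u)
    have := mul_le_mul_of_nonneg_left hexp (by positivity : 0 ≤ ρ + R)
    linarith
  by_cases hcase : 2 * (m₀ - s) ≤ 3 * j
  · have hs := step (m₀ - s) (by omega) hcase (by omega)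
    rw [show s + (m₀ - s) = m₀ by omega] at hs
    refine hs.trans ?_
    have : 2 * u ≤ 8 * d * u := by nlinarith
    gcongr
  -- Since `j ≥ k ≥ 2`, the rounded-down `J` still satisfies `J > j` and `4 * j ≤ 3 * J`.
  · obtain ⟨J, hJ⟩ : ∃ J, J = 3 * j / 2 := ⟨_, rfl⟩
    have hs := step J (by omega) (by omega) (by omega)
    have hJih := ih (m₀ - J) (by omega) J (by omega) (by omega) rfl
    have hJpos : (0 : ℝ) < J := by exact_mod_cast (by omega : 0 < J)
    have h43 : 4 * (j : ℝ) ≤ 3 * J := by exact_mod_cast (by omega : 4 * j ≤ 3 * J)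
    -- Bernoulli's inequality gives `(3 / 4) ^ (1 / d) ≤ 1 - 1 / (4 * d)`, so the exponent `8 * d *
    -- u` drops by at least `2 * u`, the price of one step.
    have hw : ((k : ℝ) / J) ^ (1 / (d : ℝ)) ≤ u * (1 - 1 / (4 * d)) := by
      have h1 : (k : ℝ) / J ≤ (k : ℝ) / j * (1 + -(1 / 4)) := by
        rw [div_mul_eq_mul_div, div_le_div_iff₀ hJpos hj0]
        nlinarith [(Nat.cast_nonneg k : (0 : ℝ) ≤ k)]
      calc ((k : ℝ) / J) ^ (1 / (d : ℝ))
          ≤ ((k : ℝ) / j * (1 + -(1 / 4))) ^ (1 / (d : ℝ)) := by gcongr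
        _ = u * (1 + -(1 / 4)) ^ (1 / (d : ℝ)) := by
          rw [Real.mul_rpow (by positivity) (by norm_num)]
        _ ≤ u * (1 + 1 / (d : ℝ) * -(1 / 4)) := by
          gcongr
          exact rpow_one_add_le_one_add_mul_self (by norm_num) (by positivity)
            (by rw [div_le_one (by linarith)]; exact hd1)
        _ = u * (1 - 1 / (4 * d)) := by
          field_simp
          ring
    calc (radCost (𝒞 (s + j)) : ℝ) + R
        ≤ (radCost (𝒞 (s + J)) + R) * Real.exp (2 * u) := hs
      _ ≤ (radCost (𝒞 m₀) + R) * Real.exp (8 * d * ((k : ℝ) / J) ^ (1 / (d : ℝ)))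
          * Real.exp (2 * u) := by gcongr
      _ = (radCost (𝒞 m₀) + R) * Real.exp (8 * d * ((k : ℝ) / J) ^ (1 / (d : ℝ)) + 2 * u) := by
        rw [mul_assoc, ← Real.exp_add]
      _ ≤ (radCost (𝒞 m₀) + R) * Real.exp (8 * d * u) := by
        gcongr
        have h2 := mul_le_mul_of_nonneg_left hw (by positivity : (0 : ℝ) ≤ 8 * d)
        have h3 : 8 * (d : ℝ) * (u * (1 - 1 / (4 * d))) = 8 * d * u - 2 * u := by
          field_simp
          ring
        linarith

end IsAgglomerativeRadiusRun

/-! ### The optimal clustering -/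

section Optimum

variable {E : Type*} [NormedAddCommGroup E] [DecidableEq E]

theorem exists_radCost_eq_optRadCost {X : Finset E} {k : ℕ} {𝒟 : Finset (Finset E)}
    (h𝒟 : IsKClustering X k 𝒟) :
    ∃ P : Finpartition X, P.parts.card = k ∧ radCost P.parts = optRadCost X k := by
  have hfin : {r | ∃ 𝒞, IsKClustering X k 𝒞 ∧ radCost 𝒞 = r}.Finite := by
    refine (X.powerset.powerset.finite_toSet.image radCost).subset ?_
    rintro r ⟨𝒞, ⟨-, P, rfl⟩, rfl⟩
    exact ⟨P.parts, Finset.mem_coe.2 <| Finset.mem_powerset.2 fun A hA =>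
    Finset.mem_powerset.2 (P.le hA), rfl⟩
  obtain ⟨𝒞, ⟨hcard, P, rfl⟩, hr⟩ :=
    (show {r | ∃ 𝒞, IsKClustering X k 𝒞 ∧ radCost 𝒞 = r}.Nonempty from
      ⟨_, 𝒟, h𝒟, rfl⟩).csInf_mem hfin
  exact ⟨P, hcard, hr⟩

theorem radCost_parts_pos [ProperSpace E] {X : Finset E} (P : Finpartition X)
    (hP : P.parts.card < X.card) : 0 < radCost P.parts := by
  obtain ⟨x, hx, y, hy, hxy, hpart⟩ := Finset.exists_ne_map_eq_of_card_lt_of_maps_to hP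
    (f := P.part) fun x hx => P.part_mem.2 hx
  rw [pos_iff_ne_zero]
  intro h0
  have hle : rad (P.part x) ≤ 0 := h0 ▸ rad_le_radCost (P.part_mem.2 hx)
  obtain ⟨c, hc⟩ := exists_center (P.part x)
  have hle' : (rad (P.part x) : ℝ) ≤ 0 := by exact_mod_cast hle
  have h1 := (hc x (P.mem_part hx)).trans hle'
  have h2 := (hc y (hpart ▸ P.mem_part hy)).trans hle'
  rw [norm_le_zero_iff, sub_eq_zero] at h1 h2
  exact hxy (h1.trans h2.symm)

end Optimum

/-! ### The last cheap stage and its cover -/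

namespace IsAgglomerativeRadiusRun

variable {E : Type*} [NormedAddCommGroup E] [DecidableEq E] {X : Finset E}
  {𝒞 : ℕ → Finset (Finset E)}

/-- Indices decrease along the run, so the last cheap stage has the least index. A union of radius
at most `r` there would make the next stage cheap as well. -/
theorem exists_last_radCost_le (h : IsAgglomerativeRadiusRun X 𝒞) {k : ℕ} (hkX : k ≤ X.card)
    {r : ℝ≥0} (hk : 1 ≤ k) (hr : r < radCost (𝒞 k)) :
    ∃ m, k < m ∧ m ≤ X.card ∧ radCost (𝒞 m) ≤ r ∧
      ∀ A ∈ 𝒞 m, ∀ B ∈ 𝒞 m, A ≠ B → r < rad (A ∪ B) := by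
  have hex : ∃ m, k ≤ m ∧ m ≤ X.card ∧ radCost (𝒞 m) ≤ r :=
    ⟨X.card, hkX, le_rfl, by rw [h.radCost_card]; exact zero_le⟩
  obtain ⟨m, ⟨hkm, hm, hmr⟩, hmin⟩ : ∃ m, (k ≤ m ∧ m ≤ X.card ∧ radCost (𝒞 m) ≤ r) ∧
      ∀ i < m, ¬ (k ≤ i ∧ i ≤ X.card ∧ radCost (𝒞 i) ≤ r) := by
    classical
    exact ⟨Nat.find hex, Nat.find_spec hex, fun i hi => Nat.find_min hex hi⟩
  have hlt : k < m := lt_of_le_of_ne hkm fun he => absurd hmr (not_le.2 (he ▸ hr))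
  refine ⟨m, hlt, hm, hmr, fun A hA B hB hAB => ?_⟩
  obtain ⟨i, rfl⟩ : ∃ i, m = i + 1 := ⟨m - 1, by omega⟩
  by_contra! hcon
  exact hmin i (by omega) ⟨by omega, by omega,
    (h.radCost_le_max (by omega) (by omega) hA hB hAB).trans (max_le hmr hcon)⟩

variable [NormedSpace ℝ E] [FiniteDimensional ℝ E]

/-- At the last stage `m` of cost at most the cost of `P`, the parts of `P` that share no cluster
with another part are clusters themselves. The others are, up to a constant factor, covered by
half as many balls. -/
theorem exists_cover (h : IsAgglomerativeRadiusRun X 𝒞) (P : Finpartition X) {m : ℕ} (hm : 1 ≤ m)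
    (hmX : m ≤ X.card) (hmr : radCost (𝒞 m) ≤ radCost P.parts)
    (hsep : ∀ A ∈ 𝒞 m, ∀ B ∈ 𝒞 m, A ≠ B → radCost P.parts < rad (A ∪ B)) :
    ∃ (s k : ℕ) (D : Finset E), s + k = P.parts.card ∧ 2 * D.card ≤ k ∧ (D = ∅ → k = 0) ∧
      (farClusters D (5 * radCost P.parts) (𝒞 m)).card ≤ s := by
  classical
  have : ProperSpace E := FiniteDimensional.proper ℝ E
  set r : ℝ := ↑(radCost P.parts) with hr
  have hr0 : 0 ≤ r := NNReal.coe_nonneg _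
  choose c hc using exists_center (E := E)
  have hcP : ∀ O ∈ P.parts, ∀ x ∈ O, ‖x - c O‖ ≤ r := fun O hO x hx =>
    (hc O x hx).trans (by exact_mod_cast rad_le_radCost hO)
  have hcA : ∀ A ∈ 𝒞 m, ∀ x ∈ A, ‖x - c A‖ ≤ r := fun A hA x hx =>
    (hc A x hx).trans (by exact_mod_cast (rad_le_radCost hA).trans hmr)
  let adj : Finset E → Finset E → Prop := fun O O' =>
    O ≠ O' ∧ ∃ A ∈ 𝒞 m, ∃ x ∈ O, ∃ y ∈ O', x ∈ A ∧ y ∈ A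
  have hsymm : ∀ O O', adj O O' → adj O' O := by
    rintro O O' ⟨hne, A, hA, x, hx, y, hy, hxA, hyA⟩
    exact ⟨hne.symm, A, hA, y, hy, x, hx, hyA, hxA⟩
  let I := P.parts.filter fun O => ∀ O' ∈ P.parts, ¬ adj O O'
  let W := P.parts.filter fun O => ¬ ∀ O' ∈ P.parts, ¬ adj O O'
  have hcardIW : I.card + W.card = P.parts.card := Finset.card_filter_add_card_filter_not _
  obtain ⟨D₀, hD₀W, hD₀card, hdom⟩ := exists_dominating_two_mul_card_le W adj hsymm
    (fun O hO => hO.1 rfl) fun O hO => by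
      obtain ⟨hOP, hO⟩ := Finset.mem_filter.1 hO
      push Not at hO
      obtain ⟨O', hO'P, hadj⟩ := hO
      exact ⟨O', Finset.mem_filter.2 ⟨hO'P, fun hiso => hiso O hOP (hsymm _ _ hadj)⟩, hadj⟩
  refine ⟨I.card, W.card, D₀.image c, hcardIW,
    (Nat.mul_le_mul_left 2 Finset.card_image_le).trans hD₀card, fun hempty => ?_, ?_⟩
  · rw [Finset.image_eq_empty] at hempty
    rw [Finset.card_eq_zero, Finset.eq_empty_iff_forall_notMem]
    intro O hO
    simpa [hempty] using hdom O hO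
  refine Finset.card_le_card fun A hA => ?_
  obtain ⟨hA, hfar⟩ := mem_farClusters.1 hA
  obtain ⟨x, hx⟩ := h.nonempty_of_mem hm hmX hA
  obtain ⟨O, hO, hxO⟩ := P.exists_mem (h.subset_of_mem hm hmX hA hx)
  have hOI : O ∈ I := by
    by_contra hOI
    have hOW : O ∈ W := by
      refine Finset.mem_filter.2 ⟨hO, fun hiso => hOI (Finset.mem_filter.2 ⟨hO, hiso⟩)⟩
    -- The path from `x` through `c O`, `y`, `c B`, `z` to `c O'` has five legs of length at most
    -- `r`; this is the source of `5 * r`.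
    rcases hdom O hOW with hOD | ⟨O', hO'D, -, B, hB, y, hy, z, hz, hyB, hzB⟩
    · have h1 := hfar x hx (c O) (Finset.mem_image_of_mem c hOD)
      linarith [hcP O hO x hxO]
    · have h1 := hfar x hx (c O') (Finset.mem_image_of_mem c hO'D)
      have h2 := hcP O hO x hxO
      have h3 := hcP O hO y hy
      have h4 := hcA B hB y hyB
      have h5 := hcA B hB z hzB
      have h6 := hcP O' (Finset.mem_filter.1 (hD₀W hO'D)).1 z hz
      rw [norm_sub_rev] at h3 h5
      have h7 := norm_sub_le_norm_sub_add_norm_sub x (c O) (c O')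
      have h8 := norm_sub_le_norm_sub_add_norm_sub (c O) y (c O')
      have h9 := norm_sub_le_norm_sub_add_norm_sub y (c B) (c O')
      have h10 := norm_sub_le_norm_sub_add_norm_sub (c B) z (c O')
      linarith
  have hiso := (Finset.mem_filter.1 hOI).2
  have hsub : ∀ B ∈ 𝒞 m, (∃ y ∈ B, y ∈ O) → B ⊆ O := by
    rintro B hB ⟨y, hyB, hyO⟩ z hz
    obtain ⟨O', hO', hzO'⟩ := P.exists_mem (h.subset_of_mem hm hmX hB hz)
    by_contra hzO
    exact hiso O' hO' ⟨fun he => hzO (he ▸ hzO'), B, hB, y, hyO, z, hzO', hyB, hz⟩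
  -- A second cluster inside `O` would give a union of radius at most `r`, against `hsep`.
  have hAO : A = O := by
    refine (hsub A hA ⟨x, hx, hxO⟩).antisymm fun y hy => ?_
    obtain ⟨B, hB, hyB⟩ := h.exists_mem hm hmX (P.le hO hy)
    by_contra hyA
    have h1 := hsep A hA B hB fun he => hyA (he ▸ hyB)
    exact absurd h1 (not_lt.2 ((rad_mono (Finset.union_subset (hsub A hA ⟨x, hx, hxO⟩)
      (hsub B hB ⟨y, hyB, hy⟩))).trans (rad_le_radCost hO)))
  exact hAO ▸ hOI

theorem radCost_le_mul_radCost_parts (h : IsAgglomerativeRadiusRun X 𝒞) {d : ℕ}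
    (hdim : Module.finrank ℝ E = d) (hd : d ≠ 0) (P : Finpartition X) (hP1 : 1 ≤ P.parts.card)
    (hP : P.parts.card < X.card) :
    (radCost (𝒞 P.parts.card) : ℝ) ≤ 6 * Real.exp (8 * d) * radCost P.parts := by
  have : ProperSpace E := FiniteDimensional.proper ℝ E
  have hr : (0 : ℝ) < radCost P.parts := by exact_mod_cast radCost_parts_pos P hP
  rcases le_or_gt (radCost (𝒞 P.parts.card)) (radCost P.parts) with hle | hlt
  · have hle' : (radCost (𝒞 P.parts.card) : ℝ) ≤ radCost P.parts := by exact_mod_cast hle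
    have h1 : 1 ≤ Real.exp (8 * d) := Real.one_le_exp (by positivity)
    nlinarith
  obtain ⟨m, hkm, hmX, hmr, hsep⟩ := h.exists_last_radCost_le hP.le hP1 hlt
  obtain ⟨s, k, D, hsk, hDk, hDempty, hfar⟩ := h.exists_cover P (by omega) hmX hmr hsep
  -- If `D` were empty, all `m` clusters would be far, so `m ≤ s ≤ P.parts.card < m`. A nonempty `D`
  -- gives `k ≥ 2`.
  have hD : D.card ≠ 0 := by
    intro hD
    rw [Finset.card_eq_zero] at hD
    have hall : farClusters D (5 * radCost P.parts) (𝒞 m) = 𝒞 m := by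
      ext A
      simp [mem_farClusters, hD]
    rw [hall, h.card_eq (by omega) hmX] at hfar
    have := hDempty hD
    omega
  have hbound := h.radCost_add_le hdim hd D (R := 5 * radCost P.parts) (by positivity) hmX hfar
    (by omega) hDk k le_rfl (by omega)
  have hk0 : (k : ℝ) ≠ 0 := by exact_mod_cast (by omega : k ≠ 0)
  rw [hsk, div_self hk0, Real.one_rpow, mul_one] at hbound
  have hmr' : (radCost (𝒞 m) : ℝ) ≤ radCost P.parts := by exact_mod_cast hmr
  have := mul_le_mul_of_nonneg_right hmr' (Real.exp_pos (8 * (d : ℝ))).le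
  linarith

end IsAgglomerativeRadiusRun

/-! ### The main theorem -/

theorem mainTheorem2 :
    ∃ a b : ℝ, 0 < a ∧ 0 < b ∧
      ∀ (E : Type*) [NormedAddCommGroup E] [NormedSpace ℝ E] [FiniteDimensional ℝ E]
        [DecidableEq E] (d : ℕ), Module.finrank ℝ E = d →
      ∀ (X : Finset E) (𝒞 : ℕ → Finset (Finset E)), IsAgglomerativeRadiusRun X 𝒞 →
      ∀ k : ℕ, 1 ≤ k → k ≤ X.card →
        IsKClustering X k (𝒞 k) ∧
        (2 ≤ k →
          (radCost (𝒞 k) : ℝ) ≤ a * Real.exp (b * d) * Real.log k * optRadCost X k) ∧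
        (radCost (𝒞 k) : ℝ) ≤
          2 * (2 * (Real.logb 2 k + 2) * (24 * d * Real.exp (24 * d) + 1) + 1 / 2)
            * optRadCost X k ∧
        (k < X.card →
          (radCost (𝒞 k) : ℝ) <
            2 * (2 * (Real.logb 2 k + 2) * (24 * d * Real.exp (24 * d) + 1) + 1 / 2)
              * optRadCost X k) := by
  -- `12` is twice the factor `6`, because `log k ≥ log 2 ≥ 1 / 2`.
  refine ⟨12, 8, by norm_num, by norm_num, ?_⟩
  intro E _ _ _ _ d hdim X 𝒞 h k hk hkX
  have hclus := h.isKClustering hk hkX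
  have hlogb : 0 ≤ Real.logb 2 k := Real.logb_nonneg (by norm_num) (by exact_mod_cast hk)
  have hlog : 0 ≤ Real.log k := Real.log_nonneg (by exact_mod_cast hk)
  rcases hkX.eq_or_lt with rfl | hlt
  · rw [h.radCost_card]
    exact ⟨hclus, fun _ => by simp only [NNReal.coe_zero]; positivity,
      by simp only [NNReal.coe_zero]; positivity, fun hlt => absurd hlt (lt_irrefl _)⟩
  obtain ⟨P, hPk, hPopt⟩ := exists_radCost_eq_optRadCost hclus
  have : ProperSpace E := FiniteDimensional.proper ℝ E
  have hopt : (0 : ℝ) < optRadCost X k := by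
    rw [← hPopt]
    exact_mod_cast radCost_parts_pos P (hPk ▸ hlt)
  have hd : d ≠ 0 := by
    rintro rfl
    have hsub : Subsingleton E := Module.finrank_zero_iff.1 hdim
    have := Finset.card_le_one_of_subsingleton X
    omega
  have hbound : (radCost (𝒞 k) : ℝ) ≤ 6 * Real.exp (8 * d) * optRadCost X k := by
    have := h.radCost_le_mul_radCost_parts hdim hd P (by omega) (by omega)
    rwa [hPk, hPopt] at this
  have hd1 : (1 : ℝ) ≤ d := by exact_mod_cast Nat.one_le_iff_ne_zero.2 hd
  have hstrict : (radCost (𝒞 k) : ℝ) <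
      2 * (2 * (Real.logb 2 k + 2) * (24 * d * Real.exp (24 * d) + 1) + 1 / 2)
        * optRadCost X k := by
    refine hbound.trans_lt (mul_lt_mul_of_pos_right ?_ hopt)
    have h1 : Real.exp (8 * d) ≤ Real.exp (24 * d) := Real.exp_le_exp.2 (by linarith)
    have h2 : Real.exp (24 * d) ≤ d * Real.exp (24 * d) :=
      le_mul_of_one_le_left (Real.exp_pos _).le hd1
    have h3 : 0 ≤ Real.logb 2 k * (24 * d * Real.exp (24 * d) + 1) := by positivity
    nlinarith [Real.exp_pos (8 * (d : ℝ))]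
  refine ⟨hclus, fun hk2 => hbound.trans ?_, hstrict.le, fun _ => hstrict⟩
  have hlog2 : 1 / 2 ≤ Real.log k :=
    (by linarith [Real.log_two_gt_d9] : (1 : ℝ) / 2 ≤ Real.log 2).trans
      (Real.log_le_log (by norm_num) (by exact_mod_cast hk2))
  refine mul_le_mul_of_nonneg_right ?_ hopt.le
  nlinarith [Real.exp_pos (8 * (d : ℝ))]
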